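/- Let $I=[a,b]$ with $a<b$ be a compact non-degenerate interval and let $f:I\to\mathbb R$ be continuous. Suppose that the graph $\{(x,f(x)):x\in I\}\subseteq\mathbb R^2$, with the Euclidean metric $d$, is $1$-monotone, i.e. there is a linear order $\prec$ on the graph such that $d(p,q)\le d(p,r)$ for all points $p\prec q\prec r$ of the graph. Then $f$ is of bounded variation on $I$, and the graph of $f$ has finite length, i.e. finite one-dimensional Hausdorff measure. -/

import Mathlib

open Set MeasureTheory
open scoped ENNReal

/-- A metric space is `c`-monotone if it carries a linear order `<` (a witnessing order, not assumed
compatible with the topology) such that `d(x,y) ≤ c d(x,z)` whenever `x < y < z`. -/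
def IsCMonotone (c : ℝ) (X : Type*) [MetricSpace X] : Prop :=
  ∃ _ : LinearOrder X, ∀ x y z : X, x < y → y < z → dist x y ≤ c * dist x z

/-- The graph of `f` restricted to `E`, as a subset of the Euclidean plane. -/
def planeGraph (f : ℝ → ℝ) (E : Set ℝ) : Set (EuclideanSpace ℝ (Fin 2)) :=
  (fun x : ℝ => !₂[x, f x]) '' E

/-- The linear (one-dimensional Hausdorff) measure of a plane set. -/
noncomputable def hausdorffLength (A : Set (EuclideanSpace ℝ (Fin 2))) : ℝ≥0∞ :=
  Measure.hausdorffMeasure 1 A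

/-! The order is open as a relation, so along the graph, an injective curve, it follows the abscissa
or its reverse. After a reflection if needed, distance from a graph point never decreases to the
right. Hence a run of `f` can be reversed steeply only if its net rise is at most twice the
horizontal distance covered. Summing over runs, horizontal length pays for all but the last, which
boundedness of `f` controls. The graph is then a `1`-Lipschitz image of a bounded set of reals. -/

/-- For an order witnessing `1`-monotonicity of a metric space, the strict order is an open
relation. -/
theorem isOpen_setOf_lt_of_dist_le {X : Type*} [MetricSpace X] [LinearOrder X]
    (h : ∀ x y z : X, x < y → y < z → dist x y ≤ dist x z) :
    IsOpen {p : X × X | p.1 < p.2} := by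
  have h' : ∀ {x y z : X}, x ≤ y → y ≤ z → dist x y ≤ dist x z := by
    intro x y z hxy hyz
    rcases hxy.lt_or_eq with hxy | rfl
    · rcases hyz.lt_or_eq with hyz | rfl
      · exact h x y z hxy hyz
      · exact le_rfl
    · simp
  have hIio : ∀ y : X, IsOpen {x | x < y} := by
    intro y
    refine Metric.isOpen_iff.2 fun x (hx : x < y) => ⟨dist x y, dist_pos.2 hx.ne, fun r hr => ?_⟩
    by_contra hry
    have := h' hx.le (not_lt.1 hry)
    rw [Metric.mem_ball, dist_comm] at hr
    linarith
  have hIoi : ∀ x : X, IsOpen {y | x < y} := by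
    intro x
    -- Half the distance suffices: `r ≤ x` gives `dist r x ≤ dist r y`, so `dist x y ≤ 2 * dist r
    -- y`.
    refine Metric.isOpen_iff.2 fun y (hy : x < y) =>
      ⟨dist x y / 2, half_pos (dist_pos.2 hy.ne), fun r hr => ?_⟩
    by_contra hrx
    have h₁ := h' (not_lt.1 hrx) hy.le
    have h₂ := dist_triangle x r y
    rw [Metric.mem_ball] at hr
    rw [dist_comm x r] at h₂
    linarith
  refine isOpen_prod_iff.2 fun x y (hxy : x < y) => ?_
  by_cases hz : ∃ z, x < z ∧ z < y
  · obtain ⟨z, hxz, hzy⟩ := hz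
    exact ⟨_, _, hIio z, hIoi z, hxz, hzy, fun p hp => lt_trans hp.1 hp.2⟩
  · push Not at hz
    refine ⟨_, _, hIio y, hIoi x, hxy, hxy, fun p hp => ?_⟩
    exact lt_of_lt_of_le hp.1 (hz p.2 hp.2)

/-- An injective curve on a convex set of reals is strictly monotone or strictly antitone for any
linear order that is open as a relation. -/
theorem strictMonoOn_or_strictAntiOn_of_isOpen_setOf_lt {X : Type*} [TopologicalSpace X]
    [LinearOrder X] (h : IsOpen {p : X × X | p.1 < p.2}) {s : Set ℝ} (hs : Convex ℝ s)
    {γ : ℝ → X} (hγ : ContinuousOn γ s) (hinj : InjOn γ s) :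
    StrictMonoOn γ s ∨ StrictAntiOn γ s := by
  let T : Set (ℝ × ℝ) := (s ×ˢ s) ∩ {p | p.1 < p.2}
  have hT : Convex ℝ T := by
    refine (hs.prod hs).inter ?_
    intro p hp q hq u v hu hv huv
    simp only [mem_ofPred_eq, Prod.fst_add, Prod.snd_add, Prod.smul_fst, Prod.smul_snd,
      smul_eq_mul] at *
    rcases hu.lt_or_eq with hu | rfl
    · nlinarith [mul_le_mul_of_nonneg_left hq.le hv, mul_lt_mul_of_pos_left hp hu]
    · obtain rfl : v = 1 := by linarith
      linarith
  have : PreconnectedSpace T := Subtype.preconnectedSpace hT.isPreconnected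
  have h₁ : Continuous fun p : T => γ p.1.1 :=
    hγ.comp_continuous (by fun_prop) fun p => p.2.1.1
  have h₂ : Continuous fun p : T => γ p.1.2 :=
    hγ.comp_continuous (by fun_prop) fun p => p.2.1.2
  have hU : IsOpen {p : T | γ p.1.1 < γ p.1.2} := h.preimage (h₁.prodMk h₂)
  have hV : IsOpen {p : T | γ p.1.2 < γ p.1.1} := h.preimage (h₂.prodMk h₁)
  have hne : ∀ p : T, γ p.1.1 ≠ γ p.1.2 := fun p hp =>
    (ne_of_lt p.2.2) (hinj p.2.1.1 p.2.1.2 hp)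
  have hc : IsClopen {p : T | γ p.1.1 < γ p.1.2} := by
    refine ⟨⟨?_⟩, hU⟩
    convert hV using 1
    ext p
    simp only [mem_compl_iff, mem_ofPred_eq, not_lt]
    exact ⟨fun hp => lt_of_le_of_ne hp (hne p).symm, le_of_lt⟩
  rcases isClopen_iff.1 hc with h0 | h1
  · right
    intro x hx y hy hxy
    have hp : (⟨(x, y), ⟨hx, hy⟩, hxy⟩ : T) ∉ {p : T | γ p.1.1 < γ p.1.2} := by simp [h0]
    exact lt_of_le_of_ne (not_lt.1 hp) (hne ⟨(x, y), ⟨hx, hy⟩, hxy⟩).symm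
  · left
    intro x hx y hy hxy
    have hp : (⟨(x, y), ⟨hx, hy⟩, hxy⟩ : T) ∈ {p : T | γ p.1.1 < γ p.1.2} := by simp [h1]
    exact hp

/-- If the distance from `(s, f s)` along the graph of `f` does not decrease, then a rise from `s`
to `y` that is followed by a drop of slope less than `-1` on `[y, v]` is at most `2 * (v - s)`. -/
theorem rise_le_of_steep_drop {f : ℝ → ℝ} {s y v : ℝ} (hsy : s ≤ y) (hyv : y ≤ v)
    (hf : ContinuousOn f (Icc y v))
    (h : ∀ z ∈ Icc y v, (y - s) ^ 2 + (f y - f s) ^ 2 ≤ (z - s) ^ 2 + (f z - f s) ^ 2)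
    (hdrop : v - y < f y - f v) : f y - f s ≤ 2 * (v - s) := by
  by_contra! hR
  rcases le_or_gt (f v) (f s) with hvs | hvs
  -- Back at height `f s`, the distance from `s` is only `z - s`.
  · obtain ⟨z, hz, hfz⟩ : f s ∈ f '' Icc y v :=
      intermediate_value_Icc' hyv hf ⟨hvs, by linarith⟩
    have := h z hz
    rw [hfz] at this
    nlinarith [hz.1, hz.2]
  · have := h v ⟨hyv, le_rfl⟩
    nlinarith [mul_pos (sub_pos.2 hdrop) (sub_pos.2 hvs),
      mul_le_mul_of_nonneg_left hR.le (sub_nonneg.2 hyv)]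

/-- Here `s` starts the current run and `σ` is its direction. A finished run costs at most `2 * (u
(n + 1) - s)`: its part up to `u n` is charged to `2 * (s - a)`, the overlapping last step to `2 *
(u n - a)`. -/
theorem sum_abs_sub_le_of_dist_graph_le {a b : ℝ} {f : ℝ → ℝ} (hf : ContinuousOn f (Icc a b))
    (h : ∀ x ∈ Icc a b, ∀ y ∈ Icc a b, ∀ z ∈ Icc a b, x ≤ y → y ≤ z →
      (y - x) ^ 2 + (f y - f x) ^ 2 ≤ (z - x) ^ 2 + (f z - f x) ^ 2)
    {u : ℕ → ℝ} (hu : Monotone u) (hmem : ∀ i, u i ∈ Icc a b) (n : ℕ) :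
    ∃ s ∈ Icc a (u n), ∃ σ : ℝ, (σ = 1 ∨ σ = -1) ∧
      ∑ i ∈ Finset.range n, |f (u (i + 1)) - f (u i)| ≤
        2 * (u n - a) + 2 * (s - a) + σ * (f (u n) - f s) := by
  induction n with
  | zero =>
    refine ⟨u 0, ⟨(hmem 0).1, le_rfl⟩, 1, Or.inl rfl, ?_⟩
    simp only [Finset.range_zero, Finset.sum_empty, sub_self]
    linarith [(hmem 0).1]
  | succ n ih =>
    obtain ⟨s, hs, σ, hσ, hsum⟩ := ih
    have hstep : u n ≤ u (n + 1) := hu n.le_succ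
    have hsI : s ∈ Icc a b := ⟨hs.1, hs.2.trans (hmem n).2⟩
    rw [Finset.sum_range_succ]
    by_cases hsteep : u (n + 1) - u n < -(σ * (f (u (n + 1)) - f (u n)))
    · -- The direction of the graph is reversed: start afresh at `u n`.
      have hsub : Icc (u n) (u (n + 1)) ⊆ Icc a b := Icc_subset_Icc (hmem n).1 (hmem _).2
      have hrise : σ * (f (u n) - f s) ≤ 2 * (u (n + 1) - s) := by
        have key : σ * f (u n) - σ * f s ≤ 2 * (u (n + 1) - s) := by
          refine rise_le_of_steep_drop (f := fun x => σ * f x) hs.2 hstep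
            ((hf.mono hsub).const_mul σ) (fun z hz => ?_) (by linarith)
          have := h s hsI (u n) (hmem n) z (hsub hz) hs.2 hz.1
          rcases hσ with rfl | rfl <;> nlinarith
        linarith
      refine ⟨u n, ⟨(hmem n).1, hstep⟩, -σ, by rcases hσ with rfl | rfl <;> simp, ?_⟩
      have habs : |f (u (n + 1)) - f (u n)| = -σ * (f (u (n + 1)) - f (u n)) := by
        rcases hσ with rfl | rfl
        · rw [abs_of_neg (by linarith)]; ring
        · rw [abs_of_pos (by linarith)]; ring
      linarith
    · refine ⟨s, ⟨hs.1, hs.2.trans hstep⟩, σ, hσ, ?_⟩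
      have habs : |f (u (n + 1)) - f (u n)| ≤
          2 * (u (n + 1) - u n) + σ * (f (u (n + 1)) - f (u n)) := by
        rcases hσ with rfl | rfl <;> refine abs_le.2 ⟨?_, ?_⟩ <;> linarith
      linarith

theorem boundedVariationOn_of_dist_graph_le {a b : ℝ} {f : ℝ → ℝ} (hf : ContinuousOn f (Icc a b))
    (h : ∀ x ∈ Icc a b, ∀ y ∈ Icc a b, ∀ z ∈ Icc a b, x ≤ y → y ≤ z →
      (y - x) ^ 2 + (f y - f x) ^ 2 ≤ (z - x) ^ 2 + (f z - f x) ^ 2) :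
    BoundedVariationOn f (Icc a b) := by
  obtain ⟨M, hM⟩ := isCompact_Icc.exists_bound_of_continuousOn hf
  refine ne_top_of_le_ne_top (ENNReal.ofReal_ne_top (r := 4 * (b - a) + 2 * M)) (iSup_le ?_)
  rintro ⟨n, u, hu, hmem⟩
  simp only [edist_dist, Real.dist_eq]
  rw [← ENNReal.ofReal_sum_of_nonneg fun _ _ => abs_nonneg _]
  refine ENNReal.ofReal_le_ofReal ?_
  obtain ⟨s, hs, σ, hσ, hsum⟩ := sum_abs_sub_le_of_dist_graph_le hf h hu hmem n
  have hn := hmem n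
  have h₁ := abs_le.1 (hM _ hn)
  have h₂ := abs_le.1 (hM s ⟨hs.1, hs.2.trans hn.2⟩)
  have := hs.2
  have := hn.2
  rcases hσ with rfl | rfl <;> linarith

theorem dist_graph_sq (f : ℝ → ℝ) (x y : ℝ) :
    dist (!₂[x, f x] : EuclideanSpace ℝ (Fin 2)) !₂[y, f y] ^ 2 =
      (y - x) ^ 2 + (f y - f x) ^ 2 := by
  rw [EuclideanSpace.dist_eq, Real.sq_sqrt (by positivity)]
  simp only [Fin.sum_univ_two, Real.dist_eq, sq_abs]
  simp
  ring

/-- The graph of a function of bounded variation on a compact interval has finite length. -/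
theorem hausdorffLength_planeGraph_lt_top {a b : ℝ} {f : ℝ → ℝ}
    (hf : BoundedVariationOn f (Icc a b)) : hausdorffLength (planeGraph f (Icc a b)) < ∞ := by
  obtain ⟨p, q, hp, hq, rfl⟩ := hf.locallyBoundedVariationOn.exists_monotoneOn_sub_monotoneOn
  set γ : ℝ → EuclideanSpace ℝ (Fin 2) := fun x => !₂[x, (p - q) x] with hγ
  -- Increments of `g` dominate chords of the graph, so `γ ∘ g⁻¹` is `1`-Lipschitz; `g` may jump.
  let g : ℝ → ℝ := fun x => x + p x + q x
  have hdist : ∀ x ∈ Icc a b, ∀ y ∈ Icc a b, x ≤ y → dist (γ x) (γ y) ≤ g y - g x := by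
    intro x hx y hy hxy
    have h₁ := hp hx hy hxy
    have h₂ := hq hx hy hxy
    refine (pow_le_pow_iff_left₀ dist_nonneg (by simp only [g]; linarith) two_ne_zero).1 ?_
    rw [hγ, dist_graph_sq]
    simp only [g, Pi.sub_apply]
    nlinarith [mul_nonneg (sub_nonneg.2 hxy) (sub_nonneg.2 h₁),
      mul_nonneg (sub_nonneg.2 hxy) (sub_nonneg.2 h₂), mul_nonneg (sub_nonneg.2 h₁) (sub_nonneg.2 h₂)]
  have hdist' : ∀ x ∈ Icc a b, ∀ y ∈ Icc a b, dist (γ x) (γ y) ≤ dist (g x) (g y) := by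
    intro x hx y hy
    rcases le_total x y with hxy | hxy
    · rw [dist_comm (g x), Real.dist_eq]
      exact (hdist x hx y hy hxy).trans (le_abs_self _)
    · rw [dist_comm, Real.dist_eq]
      exact (hdist y hy x hx hxy).trans (le_abs_self _)
  have hinj : InjOn g (Icc a b) := by
    intro x hx y hy hxy
    have h0 := hdist' x hx y hy
    rw [hxy, dist_self] at h0
    simpa [γ] using congrArg (fun v : EuclideanSpace ℝ (Fin 2) => v 0) (dist_le_zero.1 h0)
  have hinv : LeftInvOn (Function.invFunOn g (Icc a b)) g (Icc a b) := hinj.leftInvOn_invFunOn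
  have hlip : LipschitzOnWith 1 (γ ∘ Function.invFunOn g (Icc a b)) (g '' Icc a b) := by
    refine LipschitzOnWith.of_dist_le_mul ?_
    rintro _ ⟨x, hx, rfl⟩ _ ⟨y, hy, rfl⟩
    simpa [hinv hx, hinv hy] using hdist' x hx y hy
  have himage : planeGraph (p - q) (Icc a b) =
      (γ ∘ Function.invFunOn g (Icc a b)) '' (g '' Icc a b) := by
    rw [image_comp, hinv.image_image]
    rfl
  have hsub : g '' Icc a b ⊆ Icc (g a) (g b) := by
    rintro _ ⟨x, hx, rfl⟩
    have hab := hx.1.trans hx.2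
    have h₁ := hp ⟨le_rfl, hab⟩ hx hx.1
    have h₂ := hq ⟨le_rfl, hab⟩ hx hx.1
    have h₃ := hp hx ⟨hab, le_rfl⟩ hx.2
    have h₄ := hq hx ⟨hab, le_rfl⟩ hx.2
    have := hx.1
    have := hx.2
    constructor <;> simp only [g] <;> linarith
  rw [hausdorffLength, himage]
  refine (hlip.hausdorffMeasure_image_le zero_le_one).trans_lt ?_
  rw [hausdorffMeasure_real]
  simpa using (measure_mono hsub).trans_lt measure_Icc_lt_top

theorem mainTheorem7 (a b : ℝ) (hab : a < b) (f : ℝ → ℝ)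
    (hf : ContinuousOn f (Icc a b))
    (hmono : IsCMonotone 1 (planeGraph f (Icc a b))) :
    BoundedVariationOn f (Icc a b) ∧ hausdorffLength (planeGraph f (Icc a b)) < ∞ := by
  suffices hbv : BoundedVariationOn f (Icc a b) from ⟨hbv, hausdorffLength_planeGraph_lt_top hbv⟩
  obtain ⟨_, h⟩ := hmono
  simp only [one_mul] at h
  let γ : ℝ → planeGraph f (Icc a b) := fun x =>
    ⟨!₂[(projIcc a b hab.le x : ℝ), f (projIcc a b hab.le x)], _, (projIcc a b hab.le x).2, rfl⟩
  have hproj : ∀ x ∈ Icc a b, (projIcc a b hab.le x : ℝ) = x := fun x hx => by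
    rw [projIcc_of_mem hab.le hx]
  have hdist : ∀ x ∈ Icc a b, ∀ y ∈ Icc a b,
      dist (γ x) (γ y) ^ 2 = (y - x) ^ 2 + (f y - f x) ^ 2 := by
    intro x hx y hy
    simp only [γ, Subtype.dist_eq, dist_graph_sq, hproj x hx, hproj y hy]
  have hcont : ContinuousOn γ (Icc a b) := by
    refine Continuous.continuousOn (Continuous.subtype_mk ?_ _)
    have h₀ : Continuous fun x => (projIcc a b hab.le x : ℝ) :=
      continuous_subtype_val.comp continuous_projIcc
    have h₁ : Continuous fun x => f (projIcc a b hab.le x) :=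
      hf.comp_continuous h₀ fun x => (projIcc a b hab.le x).2
    refine (PiLp.continuous_toLp 2 _).comp (continuous_pi fun i => ?_)
    fin_cases i
    · exact h₀
    · exact h₁
  have hinj : InjOn γ (Icc a b) := by
    intro x hx y hy hxy
    have h0 := hdist x hx y hy
    rw [hxy, dist_self] at h0
    nlinarith [sq_nonneg (y - x), sq_nonneg (f y - f x)]
  rcases strictMonoOn_or_strictAntiOn_of_isOpen_setOf_lt (isOpen_setOf_lt_of_dist_le h)
    (convex_Icc a b) hcont hinj with hγ | hγ
  · refine boundedVariationOn_of_dist_graph_le hf fun x hx y hy z hz hxy hyz => ?_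
    rcases hxy.lt_or_eq with hxy | rfl
    · rcases hyz.lt_or_eq with hyz | rfl
      · rw [← hdist x hx y hy, ← hdist x hx z hz]
        gcongr
        exact h _ _ _ (hγ hx hy hxy) (hγ hy hz hyz)
      · exact le_rfl
    · simpa using add_nonneg (sq_nonneg _) (sq_nonneg _)
  -- Reflecting the interval reduces the reversed order to the first case.
  · have hmaps : MapsTo (fun x => a + b - x) (Icc a b) (Icc a b) := fun x hx =>
      ⟨by linarith [hx.2], by linarith [hx.1]⟩
    have hanti : AntitoneOn (fun x => a + b - x) (Icc a b) := fun x _ y _ hxy => by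
      simp only; linarith
    have hbv : BoundedVariationOn (f ∘ fun x => a + b - x) (Icc a b) := by
      refine boundedVariationOn_of_dist_graph_le (hf.comp (by fun_prop) hmaps)
        fun x hx y hy z hz hxy hyz => ?_
      rcases hxy.lt_or_eq with hxy | rfl
      · rcases hyz.lt_or_eq with hyz | rfl
        · have h₁ := hdist _ (hmaps hx) _ (hmaps hy)
          have h₂ := hdist _ (hmaps hx) _ (hmaps hz)
          have h₃ := h _ _ _ (hγ (hmaps hy) (hmaps hx) (by linarith))
            (hγ (hmaps hz) (hmaps hy) (by linarith))
          have h₄ := pow_le_pow_left₀ dist_nonneg h₃ 2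
          rw [h₁, h₂] at h₄
          simp only [Function.comp_apply]
          linarith
        · exact le_rfl
      · simpa using add_nonneg (sq_nonneg _) (sq_nonneg _)
    refine ne_top_of_le_ne_top hbv ?_
    have := eVariationOn.comp_le_of_antitoneOn (f ∘ fun x => a + b - x) _ hanti hmaps
    simpa [Function.comp_def] using this
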